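/- Let $n$ be a number of items, $c\in\mathbb R^n_{\ge 0}$ a vector of unit costs, $T>0$, and let $\sigma$ be a continuous positive density on $(0,T)$ with $\int_0^T\sigma\,dt=1$. Let $S(I,p)\in\mathbb R^n$ be the sales rates as functions of the inventory vector $I$ and the price vector $p$. For given $I_0,I_T\in\mathbb R^n$, a trajectory $(I,p,\rho)$ is feasible if $I$ is continuous on $[0,T]$, $p,\rho$ are continuous on $(0,T)$, the coordinates of $I,p,\rho,S(I,p)$ are non-negative on $(0,T)$, $$\frac{dI}{dt}=-S(I,p)\,\sigma+\rho^2\sigma\ \text{ on }(0,T),\qquad I(0)=I_0,\quad I(T)=I_T$$ (with $\rho^2$ taken componentwise), and the profit $\int_0^T[-\langle c,\rho^2\rangle+\langle p,S(I,p)\rangle]\,\sigma\,dt$ converges absolutely. A trajectory is optimal if it maximizes the profit among all feasible trajectories. A pair $(I,p)$ is optimal for the markdown problem if $(I,p,0)$ is feasible and $(I,p)$ maximizes the revenue $\int_0^T\langle p,S(I,p)\rangle\,\sigma\,dt$ among all pairs $(J,q)$ such that $(J,q,0)$ is feasible. Along a trajectory let $R=(p_iS_i)_i$ be the revenue vector,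 $\Gamma=\bigl(S_i^{-1}\,\tfrac{\partial S_i}{\partial p_j}\,p_j\bigr)_{i,j}$ the cross-elasticity matrix, and $1_n=(1,\dots,1)$. Consider trajectories along which, for all $t\in(0,T)$, $S$ is continuously differentiable in a neighbourhood of $(I(t),p(t))$, all $p_i(t)$ and all $S_i(I(t),p(t))$ are positive, and $\Gamma$ is invertible. (i) The quantity $-\langle R,\Gamma^{-1}1_n\rangle$ is constant in $t\in(0,T)$ along every such trajectory in each of the following cases: (CR) the trajectory is optimal and $\rho_i(t)\ne0$ for all $i$ and all $t\in(0,T)$; (MD) the trajectory is optimal and $\rho_i(t)=0$ for all $i$ and all $t\in(0,T)$, or it is $(I,p,0)$ with $(I,p)$ optimal for the markdown problem. (ii) In case (CR) this quantity equals the total profit rate: $\langle p-c,S\rangle=-\langle R,\Gamma^{-1}1_n\rangle$ for all $t\in(0,T)$. -/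

import Mathlib

open Set

/-- The data of a continuous-time multi-item pricing model with `n` items: the sales (demand)
rate `S(I, p)` as a function of the inventory and price vectors, the unit costs `c`, and a
positive continuous seasonality density `σ` on the selling period `(0, T)`. -/
structure PricingModel (n : ℕ) where
  /-- the demand rate `S(I, p)` -/
  S : (Fin n → ℝ) → (Fin n → ℝ) → (Fin n → ℝ)
  /-- the cost of one unit of each item -/
  c : Fin n → ℝ
  /-- the seasonality density -/
  σ : ℝ → ℝ
  /-- the length of the selling period -/
  T : ℝ
  c_nonneg : ∀ i, 0 ≤ c i
  T_pos : 0 < T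
  σ_continuousOn : ContinuousOn σ (Ioo 0 T)
  σ_pos : ∀ t ∈ Ioo 0 T, 0 < σ t
  σ_integrable : IntervalIntegrable σ MeasureTheory.volume 0 T
  σ_integral : ∫ t in (0 : ℝ)..T, σ t = 1

/-- Inventory, price and replenishment as functions of time. The (de-seasoned) replenishment
rate of item `i` is `(ρ t i) ^ 2`. -/
structure Trajectory (n : ℕ) where
  I : ℝ → Fin n → ℝ
  p : ℝ → Fin n → ℝ
  ρ : ℝ → Fin n → ℝ

namespace PricingModel

variable {n : ℕ}

/-- The rate of sales along a trajectory. -/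
def sales (M : PricingModel n) (x : Trajectory n) (t : ℝ) : Fin n → ℝ :=
  M.S (x.I t) (x.p t)

/-- The revenue rate `R = p S` (componentwise product) along a trajectory. -/
def revenueRate (M : PricingModel n) (x : Trajectory n) (t : ℝ) : Fin n → ℝ :=
  x.p t * M.sales x t

/-- The profit integrand `(-⟨c, ρ²⟩ + ⟨p, S⟩) σ`. -/
def profitIntegrand (M : PricingModel n) (x : Trajectory n) (t : ℝ) : ℝ :=
  (-(M.c ⬝ᵥ (x.ρ t) ^ 2) + x.p t ⬝ᵥ M.sales x t) * M.σ t

/-- The profit functional `∫₀ᵀ (-⟨c, ρ²⟩ + ⟨p, S⟩) σ dt`. -/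
noncomputable def profit (M : PricingModel n) (x : Trajectory n) : ℝ :=
  ∫ t in (0 : ℝ)..M.T, M.profitIntegrand x t

/-- Feasible trajectories of the replenishment problem with boundary values `I0`, `IT`.
The inventory is continuous up to the end points; prices, sales and inventory velocities may be
singular there (as happens when items sell out at time `T`), so the remaining conditions are
imposed on the open interval. -/
structure Feasible (M : PricingModel n) (I0 IT : Fin n → ℝ) (x : Trajectory n) : Prop where
  I_continuousOn : ContinuousOn x.I (Icc 0 M.T)
  p_continuousOn : ContinuousOn x.p (Ioo 0 M.T)
  ρ_continuousOn : ContinuousOn x.ρ (Ioo 0 M.T)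
  I_nonneg : ∀ t ∈ Ioo 0 M.T, ∀ i, 0 ≤ x.I t i
  p_nonneg : ∀ t ∈ Ioo 0 M.T, ∀ i, 0 ≤ x.p t i
  ρ_nonneg : ∀ t ∈ Ioo 0 M.T, ∀ i, 0 ≤ x.ρ t i
  sales_nonneg : ∀ t ∈ Ioo 0 M.T, ∀ i, 0 ≤ M.sales x t i
  /-- the inventory flow equation `dI/dt = -S σ + ρ² σ` -/
  flow : ∀ t ∈ Ioo 0 M.T,
    HasDerivAt x.I (-(M.σ t • M.sales x t) + M.σ t • (x.ρ t) ^ 2) t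
  initial : x.I 0 = I0
  terminal : x.I M.T = IT
  profit_integrable :
    IntervalIntegrable (M.profitIntegrand x) MeasureTheory.volume 0 M.T

/-- Optimal trajectories of the replenishment problem: feasible trajectories of maximal profit. -/
def IsOptimal (M : PricingModel n) (I0 IT : Fin n → ℝ) (x : Trajectory n) : Prop :=
  M.Feasible I0 IT x ∧ ∀ y, M.Feasible I0 IT y → M.profit y ≤ M.profit x

/-- The trajectory with inventory `I`, price `p` and no replenishment. -/
def _root_.Trajectory.unreplenished (I p : ℝ → Fin n → ℝ) : Trajectory n where
  I := I
  p := p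
  ρ := fun _ => 0

/-- The revenue functional `∫₀ᵀ ⟨p, S⟩ σ dt`. -/
noncomputable def revenue (M : PricingModel n) (I p : ℝ → Fin n → ℝ) : ℝ :=
  ∫ t in (0 : ℝ)..M.T, (p t ⬝ᵥ M.S (I t) (p t)) * M.σ t

/-- Optimal trajectories of the markdown problem: maximize the revenue over the inventory and
price curves that are feasible without any replenishment. -/
def IsOptimalMarkdown (M : PricingModel n) (I0 IT : Fin n → ℝ) (I p : ℝ → Fin n → ℝ) : Prop :=
  M.Feasible I0 IT (Trajectory.unreplenished I p) ∧
    ∀ J q, M.Feasible I0 IT (Trajectory.unreplenished J q) → M.revenue J q ≤ M.revenue I p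

/-- The cross-elasticity matrix `Γ i j = S_i⁻¹ (∂S_i/∂p_j) p_j` at inventory `I` and price `p`. -/
noncomputable def elasticity (M : PricingModel n) (I p : Fin n → ℝ) : Matrix (Fin n) (Fin n) ℝ :=
  Matrix.of fun i j => (M.S I p i)⁻¹ * (fderiv ℝ (M.S I) p (Pi.single j 1) i) * p j

/-- The quantity `-⟨R, Γ⁻¹ 1ₙ⟩` at time `t` along a trajectory. -/
noncomputable def invariant (M : PricingModel n) (x : Trajectory n) (t : ℝ) : ℝ :=
  -(M.revenueRate x t ⬝ᵥ Matrix.mulVec (M.elasticity (x.I t) (x.p t))⁻¹ 1)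

/-- The total profit rate `⟨p - c, S⟩` at time `t` along a trajectory. -/
def profitRate (M : PricingModel n) (x : Trajectory n) (t : ℝ) : ℝ :=
  (x.p t - M.c) ⬝ᵥ M.sales x t

/-- Along the trajectory the demand is continuously differentiable, prices and sales are positive
and the elasticity matrix is invertible, so that `Γ⁻¹` makes sense. -/
structure Regular (M : PricingModel n) (x : Trajectory n) : Prop where
  contDiffAt : ∀ t ∈ Ioo 0 M.T, ContDiffAt ℝ 1 (Function.uncurry M.S) (x.I t, x.p t)
  p_pos : ∀ t ∈ Ioo 0 M.T, ∀ i, 0 < x.p t i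
  sales_pos : ∀ t ∈ Ioo 0 M.T, ∀ i, 0 < M.sales x t i
  elasticity_isUnit : ∀ t ∈ Ioo 0 M.T, IsUnit (M.elasticity (x.I t) (x.p t)).det

/-- Every item is replenished at every time. -/
def AllReplenished (M : PricingModel n) (x : Trajectory n) : Prop :=
  ∀ t ∈ Ioo 0 M.T, ∀ i, x.ρ t i ≠ 0

/-- No item is ever replenished. -/
def AllMarkedDown (M : PricingModel n) (x : Trajectory n) : Prop :=
  ∀ t ∈ Ioo 0 M.T, ∀ i, x.ρ t i = 0

/-- A quantity is invariant if it takes the same value at all times in `(0, T)`. -/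
def TimeInvariant (M : PricingModel n) (f : ℝ → ℝ) : Prop :=
  ∃ C : ℝ, ∀ t ∈ Ioo 0 M.T, f t = C

end PricingModel

/-!
The problem is autonomous up to the seasonality density, and `-⟨R, Γ⁻¹ 1⟩` is its conserved energy.
Writing `Γ = diag(S)⁻¹ (∂S/∂p) diag(p)` gives `⟨R, Γ⁻¹ 1⟩ = ⟨S, v⟩` with `(∂S/∂p) v = S`
(`PricingModel.Regular.exists_fderiv_eq_sales`), so `-⟨R, Γ⁻¹ 1⟩` is the revenue gained on the
current sales volume, per unit of `w - 1`, when the sales `S` are lowered to `w⁻¹ S` and prices are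
raised accordingly. Since `∂S/∂p` is invertible, such prices exist near each time by the inverse
function theorem, and strict differentiability of the inverse demand makes the first-order expansion
of the gain uniform (`PricingModel.Regular.exists_local_price`).

Invariance comes from varying the speed at which the trajectory is run through. For a function `w`
close to `1` with `∫ w σ = ∫ σ`, sales and replenishment are both multiplied by `w⁻¹`; this yields
a trajectory with the same inventories that is feasible for the density `w σ`, and a change of time
(`PricingModel.Feasible.exists_timeChange`) makes it feasible for `σ` with the same profit. To first
order the profit changes by `∫ (w - 1) (-⟨R, Γ⁻¹ 1⟩) σ`, so if the quantity took different values
at two times, a slowdown near one and a speed-up near the other would be profitable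
(`PricingModel.Regular.exists_profit_lt`). The inventories visited are unchanged, so the constraint
`I ≥ 0` plays no role even where an inventory vanishes, and an unreplenished trajectory stays
unreplenished; hence one argument covers all three notions of optimality.

If all items are being replenished near a time `a`, the sales can also be multiplied by `w⁻¹` while
the replenishment absorbs the difference and the inventory is left alone. The profit then changes by
`∫ (1 - w) (⟨p - c, S⟩ + ⟨R, Γ⁻¹ 1⟩) σ` to first order, so the bracket vanishes at `a`
(`PricingModel.Regular.profitRate_eq_invariant`).
-/

/-! ### Change of time -/

section TimeChange

open MeasureTheory Filter Topology

variable {T : ℝ} {f : ℝ → ℝ}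

theorem continuousOn_integral_of_intervalIntegrable (hT : 0 < T)
    (hi : IntervalIntegrable f volume 0 T) :
    ContinuousOn (fun t => ∫ s in (0 : ℝ)..t, f s) (Icc 0 T) := by
  have := intervalIntegral.continuousOn_primitive_interval' hi left_mem_uIcc
  rwa [uIcc_of_le hT.le] at this

theorem intervalIntegrable_of_mem_Icc (hi : IntervalIntegrable f volume 0 T) {a b : ℝ}
    (ha : a ∈ Icc 0 T) (hb : b ∈ Icc 0 T) : IntervalIntegrable f volume a b := by
  refine hi.mono_set (uIcc_subset_uIcc ?_ ?_) <;> rwa [uIcc_of_le (ha.1.trans ha.2)]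

theorem strictMonoOn_integral_of_pos (hi : IntervalIntegrable f volume 0 T)
    (hf : ∀ t ∈ Ioo 0 T, 0 < f t) :
    StrictMonoOn (fun t => ∫ s in (0 : ℝ)..t, f s) (Icc 0 T) := by
  intro a ha b hb hab
  have h0 : (0 : ℝ) ∈ Icc 0 T := ⟨le_rfl, ha.1.trans ha.2⟩
  have hpos := intervalIntegral.intervalIntegral_pos_of_pos_on
    (intervalIntegrable_of_mem_Icc hi ha hb)
    (fun t ht => hf t ⟨ha.1.trans_lt ht.1, ht.2.trans_le hb.2⟩) hab
  have := intervalIntegral.integral_add_adjacent_intervals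
    (intervalIntegrable_of_mem_Icc hi h0 ha) (intervalIntegrable_of_mem_Icc hi ha hb)
  simp only
  linarith

theorem hasDerivAt_integral_of_continuousOn (hi : IntervalIntegrable f volume 0 T)
    (hc : ContinuousOn f (Ioo 0 T)) {t : ℝ} (ht : t ∈ Ioo 0 T) :
    HasDerivAt (fun t => ∫ s in (0 : ℝ)..t, f s) (f t) t := by
  have h0 : (0 : ℝ) ∈ Icc 0 T := ⟨le_rfl, ht.1.le.trans ht.2.le⟩
  exact intervalIntegral.integral_hasDerivAt_right
    (intervalIntegrable_of_mem_Icc hi h0 (Ioo_subset_Icc_self ht))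
    (hc.stronglyMeasurableAtFilter isOpen_Ioo t ht) (hc.continuousAt (isOpen_Ioo.mem_nhds ht))

/-- Two positive densities `f`, `g` on `(0, T)` of the same mass are related by a change of
variable `φ`: it is determined by `∫₀^φ(t) g = ∫₀ᵗ f`. -/
theorem exists_timeChange {g : ℝ → ℝ} (hT : 0 < T)
    (fc : ContinuousOn f (Ioo 0 T)) (gc : ContinuousOn g (Ioo 0 T))
    (fi : IntervalIntegrable f volume 0 T) (gi : IntervalIntegrable g volume 0 T)
    (fpos : ∀ t ∈ Ioo 0 T, 0 < f t) (gpos : ∀ t ∈ Ioo 0 T, 0 < g t)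
    (h : ∫ t in (0 : ℝ)..T, f t = ∫ t in (0 : ℝ)..T, g t) :
    ∃ φ : ℝ → ℝ, ContinuousOn φ (Icc 0 T) ∧ MapsTo φ (Icc 0 T) (Icc 0 T) ∧
      φ 0 = 0 ∧ φ T = T ∧ InjOn φ (Ioo 0 T) ∧ φ '' Ioo 0 T = Ioo 0 T ∧
      ∀ t ∈ Ioo 0 T, HasDerivAt φ (f t / g (φ t)) t := by
  set A : ℝ → ℝ := fun t => ∫ s in (0 : ℝ)..t, g s with hA
  set B : ℝ → ℝ := fun t => ∫ s in (0 : ℝ)..t, f s with hB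
  have Ac : ContinuousOn A (Icc 0 T) := continuousOn_integral_of_intervalIntegrable hT gi
  have Bc : ContinuousOn B (Icc 0 T) := continuousOn_integral_of_intervalIntegrable hT fi
  have Am : StrictMonoOn A (Icc 0 T) := strictMonoOn_integral_of_pos gi gpos
  have Bm : StrictMonoOn B (Icc 0 T) := strictMonoOn_integral_of_pos fi fpos
  have A0 : A 0 = 0 := by simp [hA]
  have B0 : B 0 = 0 := by simp [hB]
  have h0 : (0 : ℝ) ∈ Icc 0 T := ⟨le_rfl, hT.le⟩
  have h1 : T ∈ Icc 0 T := ⟨hT.le, le_rfl⟩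
  have hAT : B T = A T := h
  have AT0 : 0 ≤ A T := by rw [← A0]; exact Am.monotoneOn h0 h1 hT.le
  have Amaps : ∀ t ∈ Icc 0 T, A t ∈ Icc 0 (A T) := fun t ht =>
    ⟨A0 ▸ Am.monotoneOn h0 ht ht.1, Am.monotoneOn ht h1 ht.2⟩
  have Bmaps : ∀ t ∈ Icc 0 T, B t ∈ Icc 0 (A T) := fun t ht =>
    ⟨B0 ▸ Bm.monotoneOn h0 ht ht.1, hAT ▸ Bm.monotoneOn ht h1 ht.2⟩
  have Asurj : Icc 0 (A T) ⊆ A '' Icc 0 T := by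
    have := intermediate_value_Icc hT.le Ac; rwa [A0] at this
  have Bsurj : Icc 0 (A T) ⊆ B '' Icc 0 T := by
    have := intermediate_value_Icc hT.le Bc; rwa [B0, hAT] at this
  -- the inverse of `A`, extended by constants so that it is continuous on the line
  let A' : Icc (0 : ℝ) T → Icc (0 : ℝ) (A T) := fun t => ⟨A t, Amaps t t.2⟩
  have A'm : StrictMono A' := fun s t hst => Am s.2 t.2 hst
  have A's : Function.Surjective A' := by
    rintro ⟨y, hy⟩
    obtain ⟨t, ht, rfl⟩ := Asurj hy
    exact ⟨⟨t, ht⟩, rfl⟩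
  let e := A'm.orderIsoOfSurjective A' A's
  let G : ℝ → ℝ := IccExtend AT0 (fun y => ((e.symm y : Icc (0 : ℝ) T) : ℝ))
  have Gc : Continuous G := (continuous_subtype_val.comp e.symm.continuous).Icc_extend'
  have Gmem : ∀ y, G y ∈ Icc 0 T := fun y => (e.symm _).2
  have AG : ∀ y ∈ Icc 0 (A T), A (G y) = y := by
    intro y hy
    have : G y = e.symm ⟨y, hy⟩ := IccExtend_of_mem _ _ hy
    rw [this]
    exact congrArg Subtype.val (e.apply_symm_apply ⟨y, hy⟩)
  have AGB : ∀ t ∈ Icc 0 T, A (G (B t)) = B t := fun t ht => AG _ (Bmaps t ht)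
  have hφ0 : G (B 0) = 0 := Am.injOn (Gmem _) h0 (by rw [AGB 0 h0, A0, B0])
  have hφT : G (B T) = T := Am.injOn (Gmem _) h1 (by rw [AGB T h1, hAT])
  have hinj : InjOn (G ∘ B) (Icc 0 T) := by
    intro s hs t ht hst
    refine Bm.injOn hs ht ?_
    rw [← AGB s hs, ← AGB t ht]
    exact congrArg A hst
  have hmaps : ∀ t ∈ Ioo 0 T, G (B t) ∈ Ioo 0 T := by
    intro t ht
    have ht' := Ioo_subset_Icc_self ht
    refine ⟨lt_of_le_of_ne (Gmem _).1 fun hh => ?_, lt_of_le_of_ne (Gmem _).2 fun hh => ?_⟩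
    · exact ht.1.ne (hinj h0 ht' (hφ0.trans hh))
    · exact ht.2.ne (hinj ht' h1 (hh.trans hφT.symm))
  refine ⟨G ∘ B, Gc.comp_continuousOn Bc, fun t _ => Gmem _, hφ0, hφT,
    hinj.mono Ioo_subset_Icc_self, ?_, ?_⟩
  · refine Subset.antisymm (image_subset_iff.2 hmaps) fun s hs => ?_
    have hs' := Ioo_subset_Icc_self hs
    obtain ⟨t, ht, hts⟩ := Bsurj (Amaps s hs')
    have hGs : G (B t) = s := Am.injOn (Gmem _) hs' (by rw [AGB t ht, hts])
    refine ⟨t, ⟨lt_of_le_of_ne ht.1 ?_, lt_of_le_of_ne ht.2 ?_⟩, hGs⟩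
    · rintro rfl; exact hs.1.ne (hφ0.symm.trans hGs)
    · rintro rfl; exact hs.2.ne (hGs.symm.trans hφT)
  · intro t ht
    have ht' := Ioo_subset_Icc_self ht
    have hBt : B t ∈ Ioo 0 (A T) :=
      ⟨B0 ▸ Bm h0 ht' ht.1, hAT ▸ Bm ht' h1 ht.2⟩
    have hG : HasDerivAt G (g (G (B t)))⁻¹ (B t) :=
      HasDerivAt.of_local_left_inverse Gc.continuousAt
        (hasDerivAt_integral_of_continuousOn gi gc (hmaps t ht)) (gpos _ (hmaps t ht)).ne'
        (by filter_upwards [isOpen_Ioo.mem_nhds hBt] with y hy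
            exact AG y (Ioo_subset_Icc_self hy))
    have := hG.comp t (hasDerivAt_integral_of_continuousOn fi fc ht)
    rwa [inv_mul_eq_div] at this

end TimeChange

namespace PricingModel

open MeasureTheory

variable {n : ℕ}

theorem profit_eq_setIntegral (M : PricingModel n) (x : Trajectory n) :
    M.profit x = ∫ t in Ioo 0 M.T, M.profitIntegrand x t := by
  rw [profit, intervalIntegral.integral_of_le M.T_pos.le, integral_Ioc_eq_integral_Ioo]

/-- The model `M` with its seasonality density replaced by `τ`. -/
def withSeasonality (M : PricingModel n) (τ : ℝ → ℝ) (hc : ContinuousOn τ (Ioo 0 M.T))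
    (hpos : ∀ t ∈ Ioo 0 M.T, 0 < τ t) (hi : IntervalIntegrable τ volume 0 M.T)
    (h1 : ∫ t in (0 : ℝ)..M.T, τ t = 1) : PricingModel n where
  S := M.S
  c := M.c
  σ := τ
  T := M.T
  c_nonneg := M.c_nonneg
  T_pos := M.T_pos
  σ_continuousOn := hc
  σ_pos := hpos
  σ_integrable := hi
  σ_integral := h1

/-- The pricing problem does not depend on the seasonality: after a change of time, a trajectory
that is feasible for another density becomes feasible for `M`, with the same profit. -/
theorem Feasible.exists_timeChange {M : PricingModel n} {τ : ℝ → ℝ}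
    {hc : ContinuousOn τ (Ioo 0 M.T)} {hpos : ∀ t ∈ Ioo 0 M.T, 0 < τ t}
    {hi : IntervalIntegrable τ volume 0 M.T} {h1 : ∫ t in (0 : ℝ)..M.T, τ t = 1}
    {I0 IT : Fin n → ℝ} {z : Trajectory n}
    (hz : (M.withSeasonality τ hc hpos hi h1).Feasible I0 IT z) :
    ∃ φ : ℝ → ℝ, M.Feasible I0 IT ⟨z.I ∘ φ, z.p ∘ φ, z.ρ ∘ φ⟩ ∧
      M.profit ⟨z.I ∘ φ, z.p ∘ φ, z.ρ ∘ φ⟩ = (M.withSeasonality τ hc hpos hi h1).profit z := by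
  obtain ⟨φ, φc, φmaps, φ0, φT, φinj, φim, φd⟩ := _root_.exists_timeChange M.T_pos
    M.σ_continuousOn hc M.σ_integrable hi M.σ_pos hpos (M.σ_integral.trans h1.symm)
  have φmaps' : MapsTo φ (Ioo 0 M.T) (Ioo 0 M.T) := fun t ht => φim ▸ mem_image_of_mem φ ht
  have φc' : ContinuousOn φ (Ioo 0 M.T) := φc.mono Ioo_subset_Icc_self
  have heq : EqOn (M.profitIntegrand ⟨z.I ∘ φ, z.p ∘ φ, z.ρ ∘ φ⟩)
      (fun t => |M.σ t / τ (φ t)| •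
        (M.withSeasonality τ hc hpos hi h1).profitIntegrand z (φ t)) (Ioo 0 M.T) := by
    intro t ht
    have hτ := hpos _ (φmaps' ht)
    have hσ := M.σ_pos t ht
    simp only [abs_of_pos (div_pos hσ hτ), smul_eq_mul, profitIntegrand, sales, withSeasonality,
      Function.comp_apply]
    field_simp
  have φd' := fun t ht => (φd t ht).hasDerivWithinAt (s := Ioo 0 M.T)
  refine ⟨φ, ?_, ?_⟩
  · constructor
    · exact hz.I_continuousOn.comp φc φmaps
    · exact hz.p_continuousOn.comp φc' φmaps'
    · exact hz.ρ_continuousOn.comp φc' φmaps'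
    · exact fun t ht => hz.I_nonneg _ (φmaps' ht)
    · exact fun t ht => hz.p_nonneg _ (φmaps' ht)
    · exact fun t ht => hz.ρ_nonneg _ (φmaps' ht)
    · exact fun t ht => hz.sales_nonneg _ (φmaps' ht)
    · intro t ht
      have hτ := (hpos _ (φmaps' ht)).ne'
      have := (hz.flow _ (φmaps' ht)).scomp t (φd t ht)
      refine this.congr_deriv (funext fun i => ?_)
      simp only [sales, withSeasonality, Function.comp_apply, Pi.add_apply, Pi.neg_apply,
        Pi.smul_apply, smul_eq_mul]
      field_simp
    · simp [φ0, hz.initial]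
    · exact (congrArg z.I φT).trans hz.terminal
    · rw [intervalIntegrable_iff_integrableOn_Ioo_of_le M.T_pos.le]
      refine (integrableOn_congr_fun heq measurableSet_Ioo).2 ?_
      rw [← integrableOn_image_iff_integrableOn_abs_deriv_smul measurableSet_Ioo φd' φinj, φim]
      exact (intervalIntegrable_iff_integrableOn_Ioo_of_le M.T_pos.le).1 hz.profit_integrable
  · rw [profit_eq_setIntegral, profit_eq_setIntegral, setIntegral_congr_fun measurableSet_Ioo heq,
      ← integral_image_eq_integral_abs_deriv_smul measurableSet_Ioo φd' φinj, φim]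
    rfl

end PricingModel

namespace PricingModel

open Filter Topology

variable {n : ℕ}

/-! ### The elasticity matrix and the inverse demand -/

theorem elasticity_mulVec (M : PricingModel n) (I p x : Fin n → ℝ) (i : Fin n) :
    (M.elasticity I p).mulVec x i = (M.S I p i)⁻¹ * fderiv ℝ (M.S I) p (p * x) i := by
  have h : p * x = ∑ j, (p j * x j) • (Pi.single j 1 : Fin n → ℝ) := by
    ext k
    simp [Finset.sum_apply, Pi.single_apply]
  rw [h, map_sum, Finset.sum_apply, Finset.mul_sum]
  simp only [Matrix.mulVec, dotProduct, elasticity, Matrix.of_apply, map_smul, Pi.smul_apply,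
    smul_eq_mul]
  exact Finset.sum_congr rfl fun j _ => by ring

/-- If `Γ` is invertible, so is `∂S/∂p`, and `⟨R, Γ⁻¹ 1⟩ = ⟨S, (∂S/∂p)⁻¹ S⟩`; here
`v = (∂S/∂p)⁻¹ S`. -/
theorem Regular.exists_fderiv_eq_sales {M : PricingModel n} {x : Trajectory n} (hx : M.Regular x)
    {t : ℝ} (ht : t ∈ Ioo 0 M.T) :
    Function.Injective (fderiv ℝ (M.S (x.I t)) (x.p t)) ∧
      ∃ v, fderiv ℝ (M.S (x.I t)) (x.p t) v = M.sales x t ∧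
        M.invariant x t = -(v ⬝ᵥ M.sales x t) := by
  have hdet := hx.elasticity_isUnit t ht
  set Γ := M.elasticity (x.I t) (x.p t) with hΓ
  have hp : ∀ i, x.p t i ≠ 0 := fun i => (hx.p_pos t ht i).ne'
  have hS : ∀ i, M.S (x.I t) (x.p t) i ≠ 0 := fun i => (hx.sales_pos t ht i).ne'
  constructor
  · refine (injective_iff_map_eq_zero _).2 fun y hy => ?_
    have h0 : Γ.mulVec (fun i => y i / x.p t i) = 0 := by
      ext i
      have : (x.p t * fun i => y i / x.p t i) = y := by
        ext j; simp [mul_div_cancel₀ _ (hp j)]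
      rw [hΓ, elasticity_mulVec, this, hy]
      simp
    have h1 := Matrix.eq_zero_of_mulVec_eq_zero hdet.ne_zero h0
    ext i
    simpa [hp i] using congrFun h1 i
  · refine ⟨x.p t * Γ⁻¹.mulVec 1, ?_, ?_⟩
    · have h1 : Γ.mulVec (Γ⁻¹.mulVec 1) = 1 := by
        rw [Matrix.mulVec_mulVec, Matrix.mul_nonsing_inv _ hdet, Matrix.one_mulVec]
      ext i
      have := congrFun h1 i
      rw [hΓ, elasticity_mulVec, Pi.one_apply, inv_mul_eq_one₀ (hS i)] at this
      exact this.symm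
    · simp only [invariant, revenueRate, dotProduct, Pi.mul_apply]
      congr 1
      exact Finset.sum_congr rfl fun j _ => by ring

theorem Feasible.I_continuousAt {M : PricingModel n} {I0 IT : Fin n → ℝ} {x : Trajectory n}
    (hf : M.Feasible I0 IT x) {t : ℝ} (ht : t ∈ Ioo 0 M.T) : ContinuousAt x.I t :=
  (hf.flow t ht).continuousAt

theorem Feasible.p_continuousAt {M : PricingModel n} {I0 IT : Fin n → ℝ} {x : Trajectory n}
    (hf : M.Feasible I0 IT x) {t : ℝ} (ht : t ∈ Ioo 0 M.T) : ContinuousAt x.p t :=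
  hf.p_continuousOn.continuousAt (isOpen_Ioo.mem_nhds ht)

theorem Feasible.ρ_continuousAt {M : PricingModel n} {I0 IT : Fin n → ℝ} {x : Trajectory n}
    (hf : M.Feasible I0 IT x) {t : ℝ} (ht : t ∈ Ioo 0 M.T) : ContinuousAt x.ρ t :=
  hf.ρ_continuousOn.continuousAt (isOpen_Ioo.mem_nhds ht)

theorem Feasible.sales_continuousAt {M : PricingModel n} {I0 IT : Fin n → ℝ} {x : Trajectory n}
    (hf : M.Feasible I0 IT x) (hx : M.Regular x) {t : ℝ} (ht : t ∈ Ioo 0 M.T) :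
    ContinuousAt (M.sales x) t :=
  ContinuousAt.comp (f := fun s => (x.I s, x.p s)) (hx.contDiffAt t ht).continuousAt
    ((hf.I_continuousAt ht).prodMk (hf.p_continuousAt ht))

/-- Near a time `a`, the demand can be inverted along a regular trajectory: `Q (s, w)` is the price
at which the sales at inventory `I(s)` are the `w⁻¹`-fold of those along the trajectory. By strict
differentiability of the inverse demand, the revenue gained per unit of sales is
`⟨Q (s, w) - p(s), S(s)⟩ ≈ (w - 1) * (-⟨R, Γ⁻¹ 1⟩)`, uniformly for `s` near `a`. -/
theorem Regular.exists_local_price {M : PricingModel n} {I0 IT : Fin n → ℝ} {x : Trajectory n}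
    (hx : M.Regular x) (hf : M.Feasible I0 IT x) {a : ℝ} (ha : a ∈ Ioo 0 M.T) {δ : ℝ}
    (hδ : 0 < δ) :
    ∃ Q : ℝ × ℝ → Fin n → ℝ, ∀ᶠ z in 𝓝 (a, (1 : ℝ)),
      ContinuousAt Q z ∧ M.S (x.I z.1) (Q z) = z.2⁻¹ • M.sales x z.1 ∧ (∀ i, 0 ≤ Q z i) ∧
      Q (z.1, 1) = x.p z.1 ∧
      |(Q z - x.p z.1) ⬝ᵥ M.sales x z.1 - (z.2 - 1) * M.invariant x a| ≤ δ * |z.2 - 1| := by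
  obtain ⟨hinj, v, hv, hinv⟩ := hx.exists_fderiv_eq_sales ha
  set D := fderiv ℝ (M.S (x.I a)) (x.p a) with hD
  set F := Function.uncurry M.S with hF
  have hF' : HasStrictFDerivAt F (fderiv ℝ F (x.I a, x.p a)) (x.I a, x.p a) :=
    (hx.contDiffAt a ha).hasStrictFDerivAt one_ne_zero
  set F' := fderiv ℝ F (x.I a, x.p a)
  have hDF : ∀ y, F' (0, y) = D y := by
    intro y
    have : HasFDerivAt (M.S (x.I a)) (F'.comp (ContinuousLinearMap.inr ℝ _ _)) (x.p a) :=
      HasFDerivAt.comp (g := F) (x.p a) hF'.hasFDerivAt (hasFDerivAt_prodMk_right (x.I a) (x.p a))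
    rw [hD, this.fderiv]
    rfl
  -- the map `(I, p) ↦ (I, S(I, p))` is a local diffeomorphism
  let L : (Fin n → ℝ) × (Fin n → ℝ) →L[ℝ] (Fin n → ℝ) × (Fin n → ℝ) :=
    (ContinuousLinearMap.fst ℝ _ _).prod F'
  have hLinj : Function.Injective
      (L : (Fin n → ℝ) × (Fin n → ℝ) →ₗ[ℝ] (Fin n → ℝ) × (Fin n → ℝ)) := by
    refine (injective_iff_map_eq_zero _).2 ?_
    rintro ⟨y, z⟩ hyz
    have h1 : y = 0 := congrArg Prod.fst hyz
    subst h1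
    have h2 : F' (0, z) = 0 := congrArg Prod.snd hyz
    rw [hDF] at h2
    rw [(injective_iff_map_eq_zero D).1 hinj z h2]
    rfl
  let e := (LinearEquiv.ofInjectiveEndo
    (L : (Fin n → ℝ) × (Fin n → ℝ) →ₗ[ℝ] (Fin n → ℝ) × (Fin n → ℝ)) hLinj).toContinuousLinearEquiv
  have he : (e : _ →L[ℝ] _) = L := by ext <;> rfl
  have hΦ : HasStrictFDerivAt (fun y : (Fin n → ℝ) × (Fin n → ℝ) => (y.1, F y))
      (e : _ →L[ℝ] _) (x.I a, x.p a) := by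
    rw [he]; exact hasStrictFDerivAt_fst.prodMk hF'
  set Φ : (Fin n → ℝ) × (Fin n → ℝ) → (Fin n → ℝ) × (Fin n → ℝ) := fun y => (y.1, F y) with hΦdef
  set Ψ := hΦ.localInverse Φ e (x.I a, x.p a) with hΨ
  have hΨ' : HasStrictFDerivAt Ψ (e.symm : _ →L[ℝ] _) (x.I a, M.sales x a) := hΦ.to_localInverse
  have hesymm : e.symm (0, M.sales x a) = (0, v) := by
    rw [e.symm_apply_eq, ← hv, ← hDF]
    rfl
  have hΨa : Ψ (x.I a, M.sales x a) = (x.I a, x.p a) := hΦ.localInverse_apply_image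
  -- the gain as a function of inventory, sales and `w`, and its strict derivative
  let h : (Fin n → ℝ) × (Fin n → ℝ) × ℝ → ℝ := fun y => (Ψ (y.1, y.2.2⁻¹ • y.2.1)).2 ⬝ᵥ y.2.1
  obtain ⟨A, hA⟩ : ∃ A, HasStrictFDerivAt h A (x.I a, M.sales x a, (1 : ℝ)) := by
    have h21 := ((ContinuousLinearMap.fst ℝ (Fin n → ℝ) ℝ).comp (ContinuousLinearMap.snd ℝ
      (Fin n → ℝ) _)).hasStrictFDerivAt (x := (x.I a, M.sales x a, (1 : ℝ)))
    have h22 := ((ContinuousLinearMap.snd ℝ (Fin n → ℝ) ℝ).comp (ContinuousLinearMap.snd ℝ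
      (Fin n → ℝ) _)).hasStrictFDerivAt (x := (x.I a, M.sales x a, (1 : ℝ)))
    have hw := (hasStrictDerivAt_inv (one_ne_zero (α := ℝ))).hasStrictFDerivAt.comp
      (x.I a, M.sales x a, (1 : ℝ)) h22
    have hin := HasStrictFDerivAt.prodMk (hasStrictFDerivAt_fst (p := (x.I a, M.sales x a, (1 : ℝ))))
      (hw.smul h21)
    have hout := HasStrictFDerivAt.comp (g := Ψ) (x.I a, M.sales x a, (1 : ℝ))
      (by simpa using hΨ') hin
    have hq := hasStrictFDerivAt_snd.comp (x.I a, M.sales x a, (1 : ℝ)) hout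
    exact ⟨_, HasStrictFDerivAt.fun_sum (u := Finset.univ) fun i _ =>
      (hasStrictFDerivAt_pi'.1 hq i).mul (hasStrictFDerivAt_pi'.1 h21 i)⟩
  have hAw : A (0, 0, 1) = M.invariant x a := by
    have hline : HasDerivAt (fun w : ℝ => (x.I a, M.sales x a, w))
        ((0, 0, 1) : (Fin n → ℝ) × (Fin n → ℝ) × ℝ) 1 :=
      (hasDerivAt_const _ _).prodMk ((hasDerivAt_const _ _).prodMk (hasDerivAt_id _))
    have h1 := hA.hasFDerivAt.comp_hasDerivAt (1 : ℝ) hline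
    have hline2 : HasDerivAt (fun w : ℝ => (x.I a, w⁻¹ • M.sales x a))
        ((0, -M.sales x a) : (Fin n → ℝ) × (Fin n → ℝ)) 1 := by
      refine (hasDerivAt_const _ _).prodMk ?_
      simpa using (hasDerivAt_inv (one_ne_zero (α := ℝ))).smul_const (M.sales x a)
    have h2 := HasFDerivAt.comp_hasDerivAt (l := Ψ) (1 : ℝ)
      (by simpa using hΨ'.hasFDerivAt) hline2
    have h3 : (e.symm : (Fin n → ℝ) × (Fin n → ℝ) →L[ℝ] (Fin n → ℝ) × (Fin n → ℝ))
        (0, -M.sales x a) = (0, -v) := by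
      have : ((0, -M.sales x a) : (Fin n → ℝ) × (Fin n → ℝ)) = -(0, M.sales x a) := by simp
      rw [this, map_neg]
      exact (congrArg Neg.neg hesymm).trans (by simp)
    rw [h3] at h2
    have h4 : HasDerivAt (fun w : ℝ => (Ψ (x.I a, w⁻¹ • M.sales x a)).2) (-v) 1 :=
      (ContinuousLinearMap.snd ℝ (Fin n → ℝ) (Fin n → ℝ)).hasFDerivAt.comp_hasDerivAt (1 : ℝ) h2
    have h5 : HasDerivAt (fun w : ℝ => (Ψ (x.I a, w⁻¹ • M.sales x a)).2 ⬝ᵥ M.sales x a)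
        (-v ⬝ᵥ M.sales x a) 1 :=
      HasDerivAt.fun_sum fun i _ => (hasDerivAt_pi.1 h4 i).mul_const _
    rw [hinv, ← neg_dotProduct]
    exact h1.unique h5
  let Z : ℝ × ℝ → (Fin n → ℝ) × (Fin n → ℝ) := fun z => (x.I z.1, z.2⁻¹ • M.sales x z.1)
  have hmem : ∀ᶠ z : ℝ × ℝ in 𝓝 (a, (1 : ℝ)), z.1 ∈ Ioo 0 M.T ∧ z.2 ≠ 0 :=
    (continuousAt_fst.eventually (isOpen_Ioo.mem_nhds ha)).and
      (continuousAt_snd.eventually_ne one_ne_zero)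
  have hZc : ∀ z : ℝ × ℝ, z.1 ∈ Ioo 0 M.T ∧ z.2 ≠ 0 → ContinuousAt Z z := fun z hz =>
    ((hf.I_continuousAt hz.1).comp continuousAt_fst).prodMk
      ((continuousAt_snd.inv₀ hz.2).smul ((hf.sales_continuousAt hx hz.1).comp continuousAt_fst))
  have hZ : Tendsto Z (𝓝 (a, 1)) (𝓝 (x.I a, M.sales x a)) := by
    have : Tendsto Z (𝓝 (a, 1)) (𝓝 (Z (a, 1))) := hZc (a, 1) ⟨ha, one_ne_zero⟩
    simpa [Z] using this
  have hIp : Tendsto (fun z : ℝ × ℝ => (x.I z.1, x.p z.1)) (𝓝 (a, 1)) (𝓝 (x.I a, x.p a)) :=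
    ((hf.I_continuousAt ha).prodMk (hf.p_continuousAt ha)).comp (f := Prod.fst) (x := (a, (1 : ℝ)))
      continuousAt_fst
  have hΨc : ∀ᶠ y in 𝓝 (x.I a, M.sales x a), ContinuousAt Ψ y := by
    have h1 : (hΦ.toOpenPartialHomeomorph Φ).target ∈ 𝓝 (x.I a, M.sales x a) :=
      (hΦ.toOpenPartialHomeomorph Φ).open_target.mem_nhds
        hΦ.image_mem_toOpenPartialHomeomorph_target
    filter_upwards [h1] with y hy
    exact (hΦ.toOpenPartialHomeomorph Φ).continuousAt_symm hy
  have hΨpos : ∀ᶠ y in 𝓝 (x.I a, M.sales x a), ∀ i, 0 < (Ψ y).2 i := by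
    refine eventually_all.2 fun i => ?_
    have hc : ContinuousAt (fun y => (Ψ y).2 i) (x.I a, M.sales x a) :=
      (continuous_apply i).continuousAt.comp (continuousAt_snd.comp hΨ'.continuousAt)
    exact hc.eventually (lt_mem_nhds (by simpa [hΨa] using hx.p_pos a ha i))
  have hleft : ∀ᶠ z : ℝ × ℝ in 𝓝 (a, (1 : ℝ)),
      Ψ (x.I z.1, M.sales x z.1) = (x.I z.1, x.p z.1) :=
    hIp.eventually hΦ.eventually_left_inverse
  have hstrict : ∀ᶠ z : ℝ × ℝ in 𝓝 (a, (1 : ℝ)),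
      ‖h (x.I z.1, M.sales x z.1, z.2) - h (x.I z.1, M.sales x z.1, 1) -
        A ((x.I z.1, M.sales x z.1, z.2) - (x.I z.1, M.sales x z.1, 1))‖ ≤
      δ * ‖((x.I z.1, M.sales x z.1, z.2) - (x.I z.1, M.sales x z.1, 1) :
        (Fin n → ℝ) × (Fin n → ℝ) × ℝ)‖ := by
    have hI : ContinuousAt (fun z : ℝ × ℝ => x.I z.1) (a, 1) :=
      ContinuousAt.comp (f := Prod.fst) (hf.I_continuousAt ha) continuousAt_fst
    have hS : ContinuousAt (fun z : ℝ × ℝ => M.sales x z.1) (a, 1) :=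
      ContinuousAt.comp (f := Prod.fst) (hf.sales_continuousAt hx ha) continuousAt_fst
    have ht : Tendsto (fun z : ℝ × ℝ =>
        ((x.I z.1, M.sales x z.1, z.2), (x.I z.1, M.sales x z.1, (1 : ℝ)))) (𝓝 (a, 1))
        (𝓝 ((x.I a, M.sales x a, (1 : ℝ)), (x.I a, M.sales x a, (1 : ℝ)))) :=
      (hI.prodMk (hS.prodMk continuousAt_snd)).prodMk (hI.prodMk (hS.prodMk continuousAt_const))
    exact ht.eventually (hA.isLittleO.def hδ)
  refine ⟨fun z => (Ψ (Z z)).2, ?_⟩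
  filter_upwards [hmem, hZ.eventually hΨc, hZ.eventually hΨpos, hleft, hstrict,
    hZ.eventually hΦ.eventually_right_inverse] with z hz hzc hzpos hzl hzs hzr
  have hr : Φ (Ψ (Z z)) = Z z := hzr
  have hr1 : (Ψ (Z z)).1 = x.I z.1 := congrArg Prod.fst hr
  have hr2 : M.S (Ψ (Z z)).1 (Ψ (Z z)).2 = z.2⁻¹ • M.sales x z.1 := congrArg Prod.snd hr
  refine ⟨continuousAt_snd.comp (hzc.comp (hZc z hz)), by rwa [hr1] at hr2,
    fun i => (hzpos i).le, by simp [Z, hzl], ?_⟩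
  have hdiff : ((x.I z.1, M.sales x z.1, z.2) - (x.I z.1, M.sales x z.1, 1) :
      (Fin n → ℝ) × (Fin n → ℝ) × ℝ) = (z.2 - 1) • (0, 0, 1) := by simp
  have hnorm : ‖((0, 0, 1) : (Fin n → ℝ) × (Fin n → ℝ) × ℝ)‖ = 1 := by simp [Prod.norm_def]
  rw [hdiff, map_smul, hAw, norm_smul, hnorm, mul_one, Real.norm_eq_abs, Real.norm_eq_abs,
    smul_eq_mul] at hzs
  have h1 : h (x.I z.1, M.sales x z.1, 1) = x.p z.1 ⬝ᵥ M.sales x z.1 := by simp [h, hzl]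
  rw [h1] at hzs
  rwa [sub_dotProduct]

end PricingModel

namespace PricingModel

open Filter Topology MeasureTheory

variable {n : ℕ} {M : PricingModel n} {I0 IT : Fin n → ℝ} {x : Trajectory n}

/-! ### Localized variations of the price -/

/-- The tent function of radius `r` centred at `a`. -/
def tent (a r s : ℝ) : ℝ := max 0 (r - |s - a|)

theorem continuous_tent (a r : ℝ) : Continuous (tent a r) := by
  unfold tent; fun_prop

theorem tent_nonneg (a r s : ℝ) : 0 ≤ tent a r s := le_max_left _ _

theorem tent_le {r : ℝ} (hr : 0 ≤ r) (a s : ℝ) : tent a r s ≤ r :=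
  max_le hr (by linarith [abs_nonneg (s - a)])

theorem tent_eq_zero {a r s : ℝ} (h : r ≤ |s - a|) : tent a r s = 0 :=
  max_eq_left (by linarith)

theorem integrableOn_mul_seasonality (M : PricingModel n) {g : ℝ → ℝ} (hg : Continuous g) :
    IntegrableOn (fun t => g t * M.σ t) (Ioo 0 M.T) :=
  (intervalIntegrable_iff_integrableOn_Ioo_of_le M.T_pos.le).1
    (M.σ_integrable.continuousOn_mul hg.continuousOn)

theorem setIntegral_seasonality (M : PricingModel n) : ∫ t in Ioo 0 M.T, M.σ t = 1 := by
  rw [← integral_Ioc_eq_integral_Ioo, ← intervalIntegral.integral_of_le M.T_pos.le, M.σ_integral]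

theorem integral_tent_pos (M : PricingModel n) {a r : ℝ} (ha : a ∈ Ioo 0 M.T) (hr : 0 < r) :
    0 < ∫ t in Ioo 0 M.T, tent a r t * M.σ t := by
  refine (setIntegral_pos_iff_support_of_nonneg_ae ?_
    (M.integrableOn_mul_seasonality (continuous_tent a r))).2 ?_
  · filter_upwards [ae_restrict_mem measurableSet_Ioo] with t ht
    exact mul_nonneg (tent_nonneg _ _ _) (M.σ_pos t ht).le
  · refine lt_of_lt_of_le ((isOpen_Ioo.inter Metric.isOpen_ball).measure_pos volume
      ⟨a, ha, Metric.mem_ball_self hr⟩) (measure_mono ?_)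
    rintro t ⟨ht, hta⟩
    rw [Metric.mem_ball, Real.dist_eq] at hta
    exact ⟨(mul_pos (lt_max_of_lt_right (by linarith)) (M.σ_pos t ht)).ne', ht⟩

/-- The local prices of `Regular.exists_local_price`, glued to the price of the trajectory away
from `a`. The property `P` is any further condition valid for `s` near `a` and `w` near `1`. -/
theorem Regular.exists_price_variation (hx : M.Regular x) (hf : M.Feasible I0 IT x) {a : ℝ}
    (ha : a ∈ Ioo 0 M.T) {δ : ℝ} (hδ : 0 < δ) {P : ℝ → ℝ → Prop}
    (hP : ∀ᶠ z in 𝓝 (a, (1 : ℝ)), P z.1 z.2) :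
    ∃ r > 0, (∀ s w, |s - a| < r → |w - 1| < r → P s w) ∧
      ∀ w : ℝ → ℝ, Continuous w → (∀ s, |w s - 1| < r) → (∀ s, r ≤ |s - a| → w s = 1) →
        ∃ q : ℝ → Fin n → ℝ, ContinuousOn q (Ioo 0 M.T) ∧
          (∀ s, r ≤ |s - a| → q s = x.p s) ∧
          ∀ s ∈ Ioo 0 M.T, M.S (x.I s) (q s) = (w s)⁻¹ • M.sales x s ∧ (∀ i, 0 ≤ q s i) ∧
            |(q s - x.p s) ⬝ᵥ M.sales x s - (w s - 1) * M.invariant x a| ≤ δ * |w s - 1| := by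
  obtain ⟨Q, hQ⟩ := hx.exists_local_price hf ha hδ
  obtain ⟨R, hR, hball⟩ := Metric.eventually_nhds_iff.1 (hQ.and hP)
  have hball' : ∀ s w, |s - a| < R → |w - 1| < R → _ := fun s w hs hw =>
    hball (y := (s, w)) (by rw [Prod.dist_eq]; exact max_lt hs hw)
  refine ⟨R / 2, half_pos hR, fun s w hs hw => (hball' s w (by linarith) (by linarith)).2,
    fun w wc wr w1 => ?_⟩
  have hlocal : ∀ s, |s - a| < R → _ := fun s hs =>
    (hball' s (w s) hs ((wr s).trans (by linarith))).1
  have hfar : ∀ s, R / 2 ≤ |s - a| → |s - a| < R → Q (s, w s) = x.p s := fun s h1 h2 => by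
    rw [w1 s h1]
    exact (hball' s 1 h2 (by simpa using hR)).1.2.2.2.1
  refine ⟨fun s => if |s - a| < R then Q (s, w s) else x.p s, ?_, ?_, ?_⟩
  · intro s hs
    refine ContinuousAt.continuousWithinAt ?_
    have habs : Continuous fun s : ℝ => |s - a| := by fun_prop
    rcases lt_or_ge (R / 2) |s - a| with h | h
    · refine (hf.p_continuousAt hs).congr ?_
      filter_upwards [habs.continuousAt.eventually (lt_mem_nhds h)] with t ht
      split_ifs with htR
      · exact (hfar t ht.le htR).symm
      · rfl
    · have hsR : |s - a| < R := by linarith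
      have hc : ContinuousAt (fun t => Q (t, w t)) s :=
        (hlocal s hsR).1.comp (f := fun t => (t, w t)) (continuousAt_id.prodMk wc.continuousAt)
      refine hc.congr ?_
      filter_upwards [habs.continuousAt.eventually (gt_mem_nhds hsR)] with t ht
      rw [if_pos ht]
  · intro s hs
    dsimp only
    split_ifs with h
    · exact hfar s hs h
    · rfl
  · intro s hs
    dsimp only
    split_ifs with h
    · obtain ⟨-, h1, h2, -, h4⟩ := hlocal s h
      exact ⟨h1, h2, h4⟩
    · have hw := w1 s (by linarith)
      exact ⟨by simp [hw, sales], hf.p_nonneg s hs, by simp [hw]⟩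

theorem continuousOn_dotProduct {f g : ℝ → Fin n → ℝ} {s : Set ℝ} (hf : ContinuousOn f s)
    (hg : ContinuousOn g s) : ContinuousOn (fun t => f t ⬝ᵥ g t) s :=
  continuousOn_finsetSum _ fun i _ => (continuousOn_pi.1 hf i).mul (continuousOn_pi.1 hg i)

theorem continuousOn_gain (hx : M.Regular x) (hf : M.Feasible I0 IT x) {q : ℝ → Fin n → ℝ}
    (hq : ContinuousOn q (Ioo 0 M.T)) :
    ContinuousOn (fun s => (q s - x.p s) ⬝ᵥ M.sales x s) (Ioo 0 M.T) := by
  have hS : ContinuousOn (M.sales x) (Ioo 0 M.T) := fun t ht =>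
    (hf.sales_continuousAt hx ht).continuousWithinAt
  exact continuousOn_dotProduct (hq.sub hf.p_continuousOn) hS

theorem integrableOn_mul_seasonality_of_abs_le {f g : ℝ → ℝ}
    (hf : ContinuousOn f (Ioo 0 M.T)) (hg : Continuous g) (h : ∀ t ∈ Ioo 0 M.T, |f t| ≤ g t) :
    IntegrableOn (fun t => f t * M.σ t) (Ioo 0 M.T) := by
  refine (M.integrableOn_mul_seasonality hg).mono'
    ((hf.mul M.σ_continuousOn).aestronglyMeasurable measurableSet_Ioo) ?_
  filter_upwards [ae_restrict_mem measurableSet_Ioo] with t ht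
  rw [Real.norm_eq_abs, abs_mul, abs_of_pos (M.σ_pos t ht)]
  exact mul_le_mul_of_nonneg_right (h t ht) (M.σ_pos t ht).le

theorem Feasible.integrableOn_profitIntegrand (hf : M.Feasible I0 IT x) :
    IntegrableOn (M.profitIntegrand x) (Ioo 0 M.T) :=
  (intervalIntegrable_iff_integrableOn_Ioo_of_le M.T_pos.le).1 hf.profit_integrable

/-! ### Slowing down and speeding up -/

/-- Running through the inventories of `x` at `w⁻¹` times the original speed, with sales and
replenishment both scaled by `w⁻¹` and prices `q` adjusted accordingly, changes the profit by
`∫ ⟨q - p, S⟩ σ`. -/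
theorem Feasible.exists_rescaled (hf : M.Feasible I0 IT x) {w : ℝ → ℝ} {q : ℝ → Fin n → ℝ}
    (wc : Continuous w) (wpos : ∀ t ∈ Ioo 0 M.T, 0 < w t)
    (w1 : ∫ t in Ioo 0 M.T, w t * M.σ t = 1)
    (qc : ContinuousOn q (Ioo 0 M.T)) (qpos : ∀ t ∈ Ioo 0 M.T, ∀ i, 0 ≤ q t i)
    (hS : ∀ t ∈ Ioo 0 M.T, M.S (x.I t) (q t) = (w t)⁻¹ • M.sales x t)
    (hi : IntegrableOn (fun t => ((q t - x.p t) ⬝ᵥ M.sales x t) * M.σ t) (Ioo 0 M.T)) :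
    ∃ y, M.Feasible I0 IT y ∧
      M.profit y = M.profit x + ∫ t in Ioo 0 M.T, ((q t - x.p t) ⬝ᵥ M.sales x t) * M.σ t ∧
      ((x.ρ = fun _ => 0) → y.ρ = fun _ => 0) := by
  have τi : IntervalIntegrable (fun t => w t * M.σ t) volume 0 M.T :=
    (intervalIntegrable_iff_integrableOn_Ioo_of_le M.T_pos.le).2
      (M.integrableOn_mul_seasonality wc)
  have τ1 : ∫ t in (0 : ℝ)..M.T, w t * M.σ t = 1 := by
    rw [intervalIntegral.integral_of_le M.T_pos.le, integral_Ioc_eq_integral_Ioo, w1]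
  let M' := M.withSeasonality (fun t => w t * M.σ t) (wc.continuousOn.mul M.σ_continuousOn)
    (fun t ht => mul_pos (wpos t ht) (M.σ_pos t ht)) τi τ1
  let z : Trajectory n := ⟨x.I, q, fun t => √(w t)⁻¹ • x.ρ t⟩
  have hρ : ∀ t ∈ Ioo 0 M.T, z.ρ t ^ 2 = (w t)⁻¹ • x.ρ t ^ 2 := by
    intro t ht
    ext i
    simp only [z, Pi.pow_apply, Pi.smul_apply, smul_eq_mul, mul_pow,
      Real.sq_sqrt (inv_nonneg.2 (wpos t ht).le)]
  have hS' : ∀ t ∈ Ioo 0 M.T, M'.sales z t = (w t)⁻¹ • M.sales x t := hS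
  have heq : EqOn (M'.profitIntegrand z)
      (fun t => M.profitIntegrand x t + ((q t - x.p t) ⬝ᵥ M.sales x t) * M.σ t) (Ioo 0 M.T) := by
    intro t ht
    have hw := (wpos t ht).ne'
    simp only [profitIntegrand, hS' t ht, hρ t ht, dotProduct_smul, smul_eq_mul, sub_dotProduct]
    simp only [M', withSeasonality, z]
    field_simp
    ring
  have hz : M'.Feasible I0 IT z := by
    constructor
    · exact hf.I_continuousOn
    · exact qc
    · have hsqrt : ContinuousOn (fun t => √(w t)⁻¹) (Ioo 0 M.T) :=
        (wc.continuousOn.inv₀ fun t ht => (wpos t ht).ne').sqrt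
      exact hsqrt.smul hf.ρ_continuousOn
    · exact hf.I_nonneg
    · exact qpos
    · exact fun t ht i => mul_nonneg (Real.sqrt_nonneg _) (hf.ρ_nonneg t ht i)
    · intro t ht i
      rw [hS' t ht]
      exact mul_nonneg (inv_nonneg.2 (wpos t ht).le) (hf.sales_nonneg t ht i)
    · intro t ht
      have hw := (wpos t ht).ne'
      rw [hS' t ht, hρ t ht]
      simp only [M', withSeasonality, smul_smul]
      rw [mul_right_comm, mul_inv_cancel₀ hw, one_mul]
      exact hf.flow t ht
    · exact hf.initial
    · exact hf.terminal
    · exact (intervalIntegrable_iff_integrableOn_Ioo_of_le M.T_pos.le).2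
        ((integrableOn_congr_fun heq measurableSet_Ioo).2 (hf.integrableOn_profitIntegrand.add hi))
  obtain ⟨φ, hy, hprofit⟩ := hz.exists_timeChange
  refine ⟨_, hy, ?_, fun h0 => ?_⟩
  · rw [hprofit, profit_eq_setIntegral, profit_eq_setIntegral]
    exact (setIntegral_congr_fun measurableSet_Ioo heq).trans
      (integral_add hf.integrableOn_profitIntegrand hi)
  · ext t i
    simp [z, h0]

/-- If the candidate invariant were larger at time `a` than at time `b`, a small slowdown near `a`
compensated by a speed-up near `b` would increase the profit. -/
theorem Regular.exists_profit_lt (hx : M.Regular x) (hf : M.Feasible I0 IT x) {a b : ℝ}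
    (ha : a ∈ Ioo 0 M.T) (hb : b ∈ Ioo 0 M.T) (hab : M.invariant x b < M.invariant x a) :
    ∃ y, M.Feasible I0 IT y ∧ M.profit x < M.profit y ∧
      ((x.ρ = fun _ => 0) → y.ρ = fun _ => 0) := by
  have hne : a ≠ b := by rintro rfl; exact lt_irrefl _ hab
  set δ := (M.invariant x a - M.invariant x b) / 3 with hδdef
  have hδ : 0 < δ := by rw [hδdef]; linarith
  have hd : 0 < |a - b| / 2 := half_pos (abs_pos.2 (sub_ne_zero.2 hne))
  have hP : ∀ c : ℝ, ∀ᶠ z in 𝓝 (c, (1 : ℝ)), |z.1 - c| < |a - b| / 2 ∧ 0 < z.2 := by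
    intro c
    have h1 : ContinuousAt (fun z : ℝ × ℝ => |z.1 - c|) (c, 1) := by fun_prop
    exact (h1.eventually (gt_mem_nhds (by simpa using hd))).and
      (continuousAt_snd.eventually (lt_mem_nhds one_pos))
  obtain ⟨r, hr, hPa, hwa⟩ := hx.exists_price_variation hf ha hδ
    (P := fun s w => |s - a| < |a - b| / 2 ∧ 0 < w) (hP a)
  obtain ⟨r', hr', hPb, hwb⟩ := hx.exists_price_variation hf hb hδ
    (P := fun s w => |s - b| < |a - b| / 2 ∧ 0 < w) (hP b)
  have hdisj : ∀ s, r ≤ |s - a| ∨ r' ≤ |s - b| := by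
    intro s
    by_contra! h
    have h1 := (hPa s 1 h.1 (by simpa using hr)).1
    have h2 := (hPb s 1 h.2 (by simpa using hr')).1
    have := abs_sub_le a s b
    rw [abs_sub_comm a s] at this
    linarith
  set K := ∫ t in Ioo 0 M.T, tent a r t * M.σ t with hK
  set K' := ∫ t in Ioo 0 M.T, tent b r' t * M.σ t with hK'
  have Kpos : 0 < K := M.integral_tent_pos ha hr
  have K'pos : 0 < K' := M.integral_tent_pos hb hr'
  -- the variation is normalized so that `∫ (w - 1) σ = ε - ε = 0`
  obtain ⟨ε, hε, hεK, hεK'⟩ : ∃ ε > 0, ε / K < 1 ∧ ε / K' < 1 := by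
    refine ⟨min K K' / 2, half_pos (lt_min Kpos K'pos), ?_, ?_⟩
    · rw [div_lt_one Kpos]; linarith [min_le_left K K', lt_min Kpos K'pos]
    · rw [div_lt_one K'pos]; linarith [min_le_right K K', lt_min Kpos K'pos]
  have hεK0 : 0 < ε / K := div_pos hε Kpos
  have hεK0' : 0 < ε / K' := div_pos hε K'pos
  set u : ℝ → ℝ := fun s => ε / K * tent a r s with hu
  set u' : ℝ → ℝ := fun s => ε / K' * tent b r' s with hu'
  have uc : Continuous u := continuous_const.mul (continuous_tent a r)
  have uc' : Continuous u' := continuous_const.mul (continuous_tent b r')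
  have u0 : ∀ s, 0 ≤ u s := fun s => mul_nonneg hεK0.le (tent_nonneg _ _ _)
  have u0' : ∀ s, 0 ≤ u' s := fun s => mul_nonneg hεK0'.le (tent_nonneg _ _ _)
  have ur : ∀ s, u s < r := fun s => by
    nlinarith [tent_le hr.le a s, tent_nonneg a r s]
  have ur' : ∀ s, u' s < r' := fun s => by
    nlinarith [tent_le hr'.le b s, tent_nonneg b r' s]
  have uz : ∀ s, r ≤ |s - a| → u s = 0 := fun s hs => by simp [hu, tent_eq_zero hs]
  have uz' : ∀ s, r' ≤ |s - b| → u' s = 0 := fun s hs => by simp [hu', tent_eq_zero hs]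
  have ui : ∫ t in Ioo 0 M.T, u t * M.σ t = ε := by
    simp only [hu, mul_assoc]
    rw [integral_const_mul, ← hK, div_mul_cancel₀ _ Kpos.ne']
  have ui' : ∫ t in Ioo 0 M.T, u' t * M.σ t = ε := by
    simp only [hu', mul_assoc]
    rw [integral_const_mul, ← hK', div_mul_cancel₀ _ K'pos.ne']
  have uI := M.integrableOn_mul_seasonality uc
  have uI' := M.integrableOn_mul_seasonality uc'
  have habs : ∀ s, |1 + u s - 1| = u s := fun s => by
    rw [add_sub_cancel_left, abs_of_nonneg (u0 s)]
  have habs' : ∀ s, |1 - u' s - 1| = u' s := fun s => by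
    rw [sub_sub_cancel_left, abs_neg, abs_of_nonneg (u0' s)]
  obtain ⟨q, qc, qfar, hq⟩ := hwa (fun s => 1 + u s) (continuous_const.add uc)
    (fun s => (habs s).trans_lt (ur s)) (fun s hs => by simp [uz s hs])
  obtain ⟨q', qc', qfar', hq'⟩ := hwb (fun s => 1 - u' s) (continuous_const.sub uc')
    (fun s => (habs' s).trans_lt (ur' s)) (fun s hs => by simp [uz' s hs])
  have hgain : ∀ s, (q s + q' s - x.p s - x.p s) ⬝ᵥ M.sales x s =
      (q s - x.p s) ⬝ᵥ M.sales x s + (q' s - x.p s) ⬝ᵥ M.sales x s := by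
    intro s
    rw [← add_dotProduct]
    congr 1
    abel
  have hqc : ContinuousOn (fun s => q s + q' s - x.p s) (Ioo 0 M.T) :=
    (qc.add qc').sub hf.p_continuousOn
  set A := M.invariant x a with hA
  set B := M.invariant x b with hB
  have hlow : ∀ s ∈ Ioo 0 M.T, (A - δ) * u s - (B + δ) * u' s ≤
      (q s + q' s - x.p s - x.p s) ⬝ᵥ M.sales x s := by
    intro s hs
    have h1 := (hq s hs).2.2
    have h2 := (hq' s hs).2.2
    rw [habs] at h1
    rw [habs'] at h2
    rw [hgain]
    linarith [(abs_le.1 h1).1, (abs_le.1 h2).1]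
  have hup : ∀ s ∈ Ioo 0 M.T, |(q s + q' s - x.p s - x.p s) ⬝ᵥ M.sales x s| ≤
      (|A| + δ) * u s + (|B| + δ) * u' s := by
    intro s hs
    have h1 := abs_le.1 (hq s hs).2.2
    have h2 := abs_le.1 (hq' s hs).2.2
    rw [habs] at h1
    rw [habs'] at h2
    have h3 : |A * u s| = |A| * u s := by rw [abs_mul, abs_of_nonneg (u0 s)]
    have h4 : |B * u' s| = |B| * u' s := by rw [abs_mul, abs_of_nonneg (u0' s)]
    have h5 := abs_le.1 h3.le
    have h6 := abs_le.1 h4.le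
    rw [hgain, abs_le]
    constructor <;> linarith [h1.1, h1.2, h2.1, h2.2, h5.1, h5.2, h6.1, h6.2]
  have hint : IntegrableOn (fun t => ((q t + q' t - x.p t - x.p t) ⬝ᵥ M.sales x t) * M.σ t)
      (Ioo 0 M.T) :=
    integrableOn_mul_seasonality_of_abs_le (continuousOn_gain hx hf hqc)
      ((continuous_const.mul uc).add (continuous_const.mul uc')) hup
  -- at each time, only one of the two variations is active
  have hcase : ∀ s ∈ Ioo 0 M.T, 0 < 1 + u s - u' s ∧ (∀ i, 0 ≤ (q s + q' s - x.p s) i) ∧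
      M.S (x.I s) (q s + q' s - x.p s) = (1 + u s - u' s)⁻¹ • M.sales x s := by
    intro s hs
    rcases hdisj s with h | h
    · have hpos : 0 < 1 - u' s := by
        by_cases h' : r' ≤ |s - b|
        · simp [uz' s h']
        · exact (hPb s _ (not_le.1 h') ((habs' s).trans_lt (ur' s))).2
      rw [qfar s h, uz s h, add_sub_cancel_left, add_zero]
      exact ⟨hpos, (hq' s hs).2.1, (hq' s hs).1⟩
    · rw [qfar' s h, uz' s h, add_sub_cancel_right, sub_zero]
      exact ⟨by linarith [u0 s], (hq s hs).2.1, (hq s hs).1⟩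
  have hw1 : ∫ t in Ioo 0 M.T, (1 + u t - u' t) * M.σ t = 1 := by
    have h1 : IntegrableOn (fun t => M.σ t + u t * M.σ t) (Ioo 0 M.T) := by
      refine IntegrableOn.add ?_ uI
      simpa using M.integrableOn_mul_seasonality (continuous_const (y := (1 : ℝ)))
    simp only [sub_mul, add_mul, one_mul]
    rw [integral_sub h1 uI', integral_add _ uI, ui, ui', M.setIntegral_seasonality]
    · ring
    · simpa [IntegrableOn] using
        M.integrableOn_mul_seasonality (continuous_const (y := (1 : ℝ)))
  obtain ⟨y, hy, hprofit, hρ⟩ := hf.exists_rescaled (w := fun s => 1 + u s - u' s)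
    ((continuous_const.add uc).sub uc') (fun s hs => (hcase s hs).1) hw1 hqc
    (fun s hs => (hcase s hs).2.1) (fun s hs => (hcase s hs).2.2) hint
  refine ⟨y, hy, ?_, hρ⟩
  have hlowI := M.integrableOn_mul_seasonality (g := fun t => (A - δ) * u t - (B + δ) * u' t)
    (((continuous_const (y := A - δ)).mul uc).sub ((continuous_const (y := B + δ)).mul uc'))
  have hle := setIntegral_mono_on hlowI hint measurableSet_Ioo fun s hs =>
    mul_le_mul_of_nonneg_right (hlow s hs) (M.σ_pos s hs).le
  have hval : ∫ t in Ioo 0 M.T, ((A - δ) * u t - (B + δ) * u' t) * M.σ t = ε * δ := by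
    simp only [sub_mul _ _ (M.σ _), mul_assoc]
    rw [integral_sub (uI.const_mul _) (uI'.const_mul _), integral_const_mul, integral_const_mul,
      ui, ui', hδdef]
    ring
  have := mul_pos hε hδ
  rw [hprofit]
  linarith

theorem Regular.timeInvariant (hx : M.Regular x) (hf : M.Feasible I0 IT x)
    (hmax : ∀ y, M.Feasible I0 IT y → ((x.ρ = fun _ => 0) → y.ρ = fun _ => 0) →
      M.profit y ≤ M.profit x) :
    M.TimeInvariant (M.invariant x) := by
  have hle : ∀ a ∈ Ioo 0 M.T, ∀ b ∈ Ioo 0 M.T, M.invariant x a ≤ M.invariant x b := by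
    intro a ha b hb
    by_contra! h
    obtain ⟨y, hy, hlt, hρ⟩ := hx.exists_profit_lt hf ha hb h
    exact (hmax y hy hρ).not_gt hlt
  have hT : M.T / 2 ∈ Ioo 0 M.T := ⟨half_pos M.T_pos, half_lt_self M.T_pos⟩
  exact ⟨M.invariant x (M.T / 2), fun t ht => le_antisymm (hle _ ht _ hT) (hle _ hT _ ht)⟩

/-! ### Selling and replenishing more at a fixed inventory -/

/-- Changing the sales to `w⁻¹ S` by means of prices `q`, and compensating by replenishment so
that the inventory stays the same. -/
theorem Feasible.compensated (hx : M.Regular x) (hf : M.Feasible I0 IT x) {w : ℝ → ℝ}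
    {q : ℝ → Fin n → ℝ} (wc : Continuous w) (wpos : ∀ t ∈ Ioo 0 M.T, 0 < w t)
    (qc : ContinuousOn q (Ioo 0 M.T)) (qpos : ∀ t ∈ Ioo 0 M.T, ∀ i, 0 ≤ q t i)
    (hS : ∀ t ∈ Ioo 0 M.T, M.S (x.I t) (q t) = (w t)⁻¹ • M.sales x t)
    (hρ : ∀ t ∈ Ioo 0 M.T, ∀ i, 0 ≤ x.ρ t i ^ 2 + ((w t)⁻¹ - 1) * M.sales x t i)
    (hi : IntegrableOn (fun t => ((w t)⁻¹ * ((1 - w t) * M.profitRate x t +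
      (q t - x.p t) ⬝ᵥ M.sales x t)) * M.σ t) (Ioo 0 M.T)) :
    ∃ y, M.Feasible I0 IT y ∧
      M.profit y = M.profit x + ∫ t in Ioo 0 M.T, ((w t)⁻¹ * ((1 - w t) * M.profitRate x t +
        (q t - x.p t) ⬝ᵥ M.sales x t)) * M.σ t := by
  let y : Trajectory n :=
    ⟨x.I, q, fun t i => √(x.ρ t i ^ 2 + ((w t)⁻¹ - 1) * M.sales x t i)⟩
  have hρ' : ∀ t ∈ Ioo 0 M.T, y.ρ t ^ 2 = x.ρ t ^ 2 + ((w t)⁻¹ - 1) • M.sales x t := by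
    intro t ht
    ext i
    simp only [y, Pi.pow_apply, Real.sq_sqrt (hρ t ht i), Pi.add_apply, Pi.smul_apply, smul_eq_mul]
  have hS' : ∀ t ∈ Ioo 0 M.T, M.sales y t = (w t)⁻¹ • M.sales x t := hS
  have hSc : ContinuousOn (M.sales x) (Ioo 0 M.T) := fun t ht =>
    (hf.sales_continuousAt hx ht).continuousWithinAt
  have heq : EqOn (M.profitIntegrand y) (fun t => M.profitIntegrand x t +
      ((w t)⁻¹ * ((1 - w t) * M.profitRate x t + (q t - x.p t) ⬝ᵥ M.sales x t)) * M.σ t)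
      (Ioo 0 M.T) := by
    intro t ht
    have hw := (wpos t ht).ne'
    simp only [profitIntegrand, profitRate, hS' t ht, hρ' t ht, dotProduct_smul, dotProduct_add,
      smul_eq_mul, sub_dotProduct, y]
    field_simp
    ring
  refine ⟨y, ?_, ?_⟩
  · constructor
    · exact hf.I_continuousOn
    · exact qc
    · refine continuousOn_pi.2 fun i => ContinuousOn.sqrt ?_
      exact ((continuousOn_pi.1 hf.ρ_continuousOn i).pow 2).add
        (((wc.continuousOn.inv₀ fun t ht => (wpos t ht).ne').sub continuousOn_const).mul
          (continuousOn_pi.1 hSc i))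
    · exact hf.I_nonneg
    · exact qpos
    · exact fun t ht i => Real.sqrt_nonneg _
    · intro t ht i
      rw [hS' t ht]
      exact mul_nonneg (inv_nonneg.2 (wpos t ht).le) (hf.sales_nonneg t ht i)
    · intro t ht
      refine (hf.flow t ht).congr_deriv ?_
      rw [hS' t ht, hρ' t ht]
      module
    · exact hf.initial
    · exact hf.terminal
    · exact (intervalIntegrable_iff_integrableOn_Ioo_of_le M.T_pos.le).2
        ((integrableOn_congr_fun heq measurableSet_Ioo).2 (hf.integrableOn_profitIntegrand.add hi))
  · rw [profit_eq_setIntegral, profit_eq_setIntegral,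
      setIntegral_congr_fun measurableSet_Ioo heq, integral_add hf.integrableOn_profitIntegrand hi]

/-- At a time when all items are being replenished, an optimal trajectory balances the marginal
profit `⟨p - c, S⟩` of scaling the sales up against the revenue lost through lower prices. -/
theorem Regular.profitRate_eq_invariant (hx : M.Regular x) (hopt : M.IsOptimal I0 IT x) {a : ℝ}
    (ha : a ∈ Ioo 0 M.T) (hρ : ∀ i, x.ρ a i ≠ 0) : M.profitRate x a = M.invariant x a := by
  obtain ⟨hf, hmax⟩ := hopt
  by_contra hne
  set k := M.profitRate x a - M.invariant x a with hk
  have hk0 : 0 < |k| := abs_pos.2 (sub_ne_zero.2 hne)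
  have hδ : 0 < |k| / 4 := by linarith
  have hSc : ∀ t ∈ Ioo 0 M.T, ContinuousAt (M.sales x) t := fun t ht =>
    hf.sales_continuousAt hx ht
  have hprc : ContinuousOn (M.profitRate x) (Ioo 0 M.T) := by
    have hpc : ContinuousOn (fun t => x.p t - M.c) (Ioo 0 M.T) :=
      hf.p_continuousOn.sub continuousOn_const
    have hsc : ContinuousOn (M.sales x) (Ioo 0 M.T) := fun t ht => (hSc t ht).continuousWithinAt
    exact continuousOn_dotProduct hpc hsc
  have hP : ∀ᶠ z in 𝓝 (a, (1 : ℝ)), (1 / 2 < z.2 ∧ z.2 < 2) ∧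
      |M.profitRate x z.1 - M.profitRate x a| ≤ |k| / 4 ∧
      ∀ i, 0 ≤ x.ρ z.1 i ^ 2 + (z.2⁻¹ - 1) * M.sales x z.1 i := by
    have h1 : ∀ᶠ z in 𝓝 (a, (1 : ℝ)), 1 / 2 < z.2 ∧ z.2 < 2 :=
      continuousAt_snd.eventually (Ioo_mem_nhds (by norm_num) (by norm_num))
    have h2 : ∀ᶠ s in 𝓝 a, |M.profitRate x s - M.profitRate x a| < |k| / 4 := by
      have hc := hprc.continuousAt (isOpen_Ioo.mem_nhds ha)
      exact (hc.sub continuousAt_const).abs.eventually (gt_mem_nhds (by simpa using hδ))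
    have h3 : ∀ᶠ z in 𝓝 (a, (1 : ℝ)), ∀ i,
        0 < x.ρ z.1 i ^ 2 + (z.2⁻¹ - 1) * M.sales x z.1 i := by
      refine eventually_all.2 fun i => ?_
      have hρc : ContinuousAt (fun z : ℝ × ℝ => x.ρ z.1 i) (a, 1) :=
        ContinuousAt.comp (f := Prod.fst) (g := fun s => x.ρ s i) (continuousAt_pi.1 (hf.ρ_continuousAt ha) i)
          continuousAt_fst
      have hsc : ContinuousAt (fun z : ℝ × ℝ => M.sales x z.1 i) (a, 1) :=
        ContinuousAt.comp (f := Prod.fst) (g := fun s => M.sales x s i) (continuousAt_pi.1 (hSc a ha) i) continuousAt_fst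
      have hw : ContinuousAt (fun z : ℝ × ℝ => z.2⁻¹ - 1) (a, 1) :=
        (continuousAt_snd.inv₀ one_ne_zero).sub continuousAt_const
      refine ((hρc.pow 2).add (hw.mul hsc)).eventually (lt_mem_nhds ?_)
      have := pow_pos (abs_pos.2 (hρ i)) 2
      rw [sq_abs] at this
      simpa using this
    filter_upwards [h1, continuousAt_fst.eventually h2, h3] with z hz1 hz2 hz3
    exact ⟨hz1, hz2.le, fun i => (hz3 i).le⟩
  obtain ⟨r, hr, hPr, hw⟩ := hx.exists_price_variation hf ha hδ (P := fun s w => (1 / 2 < w ∧ w < 2) ∧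
    |M.profitRate x s - M.profitRate x a| ≤ |k| / 4 ∧
    ∀ i, 0 ≤ x.ρ s i ^ 2 + (w⁻¹ - 1) * M.sales x s i) hP
  -- the sales are increased if `k > 0` and decreased if `k < 0`
  set u : ℝ → ℝ := fun s => k / (2 * |k|) * tent a r s with hu
  have uc : Continuous u := continuous_const.mul (continuous_tent a r)
  have uabs : ∀ s, |u s| = tent a r s / 2 := fun s => by
    simp only [hu, abs_mul, abs_div, abs_abs, abs_two, abs_of_nonneg (tent_nonneg a r s)]
    field_simp
  have uk : ∀ s, u s * k = |u s| * |k| := fun s => by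
    rw [uabs]
    simp only [hu]
    field_simp
    rw [sq_abs]
  have ur : ∀ s, |u s| < r := fun s => by rw [uabs]; linarith [tent_le hr.le a s]
  have uz : ∀ s, r ≤ |s - a| → u s = 0 := fun s hs => by simp [hu, tent_eq_zero hs]
  have habs : ∀ s, |1 - u s - 1| = |u s| := fun s => by rw [sub_sub_cancel_left, abs_neg]
  obtain ⟨q, qc, qfar, hq⟩ := hw (fun s => 1 - u s) (continuous_const.sub uc)
    (fun s => (habs s).trans_lt (ur s)) (fun s hs => by simp [uz s hs])
  have hw2 : ∀ s, 1 / 2 < 1 - u s ∧ 1 - u s < 2 := by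
    intro s
    by_cases h : r ≤ |s - a|
    · rw [uz s h]; norm_num
    · exact (hPr s (1 - u s) (not_le.1 h) ((habs s).trans_lt (ur s))).1
  have hρ' : ∀ s ∈ Ioo 0 M.T, ∀ i, 0 ≤ x.ρ s i ^ 2 + ((1 - u s)⁻¹ - 1) * M.sales x s i := by
    intro s _
    by_cases h : r ≤ |s - a|
    · intro i
      rw [uz s h]
      simpa using sq_nonneg (x.ρ s i)
    · exact (hPr s (1 - u s) (not_le.1 h) ((habs s).trans_lt (ur s))).2.2
  set b : ℝ → ℝ := fun s => (1 - (1 - u s)) * M.profitRate x s +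
    (q s - x.p s) ⬝ᵥ M.sales x s with hb
  have hbk : ∀ s ∈ Ioo 0 M.T, |b s - (|u s| * |k|)| ≤ |u s| * (|k| / 2) := by
    intro s hs
    have h1 := (hq s hs).2.2
    rw [habs] at h1
    have h2 : |u s * (M.profitRate x s - M.profitRate x a)| ≤ |u s| * (|k| / 4) := by
      by_cases h : r ≤ |s - a|
      · simp [uz s h]
      · rw [abs_mul]
        exact mul_le_mul_of_nonneg_left
          (hPr s 1 (not_le.1 h) (by simpa using hr)).2.1 (abs_nonneg _)
    have h3 : b s - |u s| * |k| = u s * (M.profitRate x s - M.profitRate x a) +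
        ((q s - x.p s) ⬝ᵥ M.sales x s - (1 - u s - 1) * M.invariant x a) := by
      rw [← uk, hk]
      simp only [hb]
      ring
    rw [h3]
    refine (abs_add_le _ _).trans ?_
    linarith
  have hinv : ∀ s, 1 / 2 ≤ (1 - u s)⁻¹ ∧ (1 - u s)⁻¹ ≤ 2 := by
    intro s
    obtain ⟨h1, h2⟩ := hw2 s
    have h0 : 0 < 1 - u s := by linarith
    constructor
    · rw [one_div]; exact inv_anti₀ h0 h2.le
    · rw [inv_le_comm₀ h0 two_pos, ← one_div]; exact h1.le
  have hup : ∀ s ∈ Ioo 0 M.T, |(1 - u s)⁻¹ * b s| ≤ 3 * |k| * |u s| := by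
    intro s hs
    have h1 := abs_le.1 (hbk s hs)
    have h0 := mul_nonneg (abs_nonneg (u s)) hk0.le
    have h2 : |b s| ≤ 3 / 2 * (|u s| * |k|) := abs_le.2 ⟨by linarith, by linarith⟩
    rw [abs_mul, abs_of_nonneg ((by norm_num : (0 : ℝ) ≤ 1 / 2).trans (hinv s).1)]
    nlinarith [(hinv s).2, abs_nonneg (b s)]
  have hlow : ∀ s ∈ Ioo 0 M.T, |k| / 8 * tent a r s ≤ (1 - u s)⁻¹ * b s := by
    intro s hs
    have h1 := abs_le.1 (hbk s hs)
    have h0 := mul_nonneg (abs_nonneg (u s)) hk0.le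
    have h2 : 1 / 2 * (|u s| * |k|) ≤ b s := by linarith
    have h3 : |u s| * |k| = tent a r s / 2 * |k| := by rw [uabs]
    nlinarith [(hinv s).1]
  have hbc : ContinuousOn (fun s => (1 - u s)⁻¹ * b s) (Ioo 0 M.T) := by
    refine ContinuousOn.mul ?_ ?_
    · exact (continuous_const.sub uc).continuousOn.inv₀ fun s _ =>
        (by linarith [(hw2 s).1] : 0 < 1 - u s).ne'
    · exact ((continuous_const.sub (continuous_const.sub uc)).continuousOn.mul hprc).add
        (continuousOn_gain hx hf qc)
  have hint := integrableOn_mul_seasonality_of_abs_le hbc (continuous_const.mul uc.abs) hup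
  obtain ⟨y, hy, hprofit⟩ := hf.compensated hx (w := fun s => 1 - u s)
    (continuous_const.sub uc) (fun s _ => by linarith [(hw2 s).1]) qc
    (fun s hs => (hq s hs).2.1) (fun s hs => (hq s hs).1) hρ' hint
  have hlowI := M.integrableOn_mul_seasonality (g := fun t => |k| / 8 * tent a r t)
    ((continuous_const (y := |k| / 8)).mul (continuous_tent a r))
  have hle := setIntegral_mono_on hlowI hint measurableSet_Ioo fun s hs =>
    mul_le_mul_of_nonneg_right (hlow s hs) (M.σ_pos s hs).le
  have hpos : 0 < ∫ t in Ioo 0 M.T, |k| / 8 * tent a r t * M.σ t := by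
    simp only [mul_assoc]
    rw [integral_const_mul]
    exact mul_pos (by linarith) (M.integral_tent_pos ha hr)
  linarith [hmax y hy]

theorem profit_eq_revenue (hρ : x.ρ = fun _ => 0) : M.profit x = M.revenue x.I x.p := by
  simp [profit, revenue, profitIntegrand, sales, hρ]

end PricingModel

theorem corollary2 {n : ℕ} (M : PricingModel n) (I0 IT : Fin n → ℝ) :
    (∀ x : Trajectory n, M.IsOptimal I0 IT x → M.Regular x → M.AllReplenished x →
      M.TimeInvariant (M.invariant x) ∧
        ∀ t ∈ Set.Ioo 0 M.T, M.profitRate x t = M.invariant x t) ∧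
    (∀ x : Trajectory n, M.IsOptimal I0 IT x → M.Regular x → M.AllMarkedDown x →
      M.TimeInvariant (M.invariant x)) ∧
    (∀ I p : ℝ → Fin n → ℝ, M.IsOptimalMarkdown I0 IT I p →
      M.Regular (Trajectory.unreplenished I p) →
      M.TimeInvariant (M.invariant (Trajectory.unreplenished I p))) := by
  have hinv : ∀ x : Trajectory n, M.IsOptimal I0 IT x → M.Regular x →
      M.TimeInvariant (M.invariant x) := fun x hopt hx =>
    hx.timeInvariant hopt.1 fun y hy _ => hopt.2 y hy
  refine ⟨fun x hopt hx hρ => ⟨hinv x hopt hx, fun t ht =>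
    hx.profitRate_eq_invariant hopt ht (hρ t ht)⟩, fun x hopt hx _ => hinv x hopt hx,
    fun I p hopt hx => hx.timeInvariant hopt.1 fun y hy hρ => ?_⟩
  obtain ⟨J, q, ρ⟩ := y
  obtain rfl : ρ = fun _ => 0 := hρ rfl
  rw [PricingModel.profit_eq_revenue rfl, PricingModel.profit_eq_revenue rfl]
  exact hopt.2 J q hy
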